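/- All topological spaces are Hausdorff. A mapping $f:F\to E$ between topological spaces is called nearly continuous if $f^{-1}(V)\subseteq \operatorname{int}\bigl(\overline{f^{-1}(V)}\bigr)$ for every open $V\subseteq E$, and separating if for all $x,y\in E$ with $x\neq y$ there exist neighborhoods $V_x$ of $x$ and $V_y$ of $y$ in $E$ such that $\overline{f^{-1}(V_x)}\cap f^{-1}(V_y)=\emptyset=f^{-1}(V_x)\cap\overline{f^{-1}(V_y)}$. Let $\mathscr M$ be the class of metrizable spaces. A space $E$ is called a $C(\mathscr M)$-space if every nearly continuous mapping $f:F\to E$ with closed graph in $F\times E$, where $F\in\mathscr M$, is continuous; it is called a $C_s(\mathscr M)$-space if every nearly continuous separating mapping $f:F\to E$, where $F\in\mathscr M$, is continuous. Proposition. Let $E$ be a metrizable $C_s(\mathscr M)$-space. Then $E$ is F-hereditary Baire, that is, every closed subspace of $E$ is a Baire space (countable intersections of dense open subsets are dense). The same is true for every metrizable $C(\mathscr M)$-space. -/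

import Mathlib

open Set Topology

universe u

/-- `f` is nearly continuous: `f⁻¹(V) ⊆ int (cl (f⁻¹(V)))` for every open `V`. -/
def NearlyContinuous {F E : Type*} [TopologicalSpace F] [TopologicalSpace E] (f : F → E) : Prop :=
  ∀ V : Set E, IsOpen V → f ⁻¹' V ⊆ interior (closure (f ⁻¹' V))

/-- The graph of `f` is closed in `F × E`. -/
def HasClosedGraph {F E : Type*} [TopologicalSpace F] [TopologicalSpace E] (f : F → E) : Prop :=
  IsClosed {p : F × E | f p.1 = p.2}

/-- `f` is separating: distinct points `x`, `y` of the target have neighborhoods whose preimages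
are separated sets, i.e. each is disjoint from the closure of the other. -/
def IsSeparatingMap {F E : Type*} [TopologicalSpace F] [TopologicalSpace E] (f : F → E) : Prop :=
  ∀ x y : E, x ≠ y → ∃ Vx ∈ 𝓝 x, ∃ Vy ∈ 𝓝 y,
    closure (f ⁻¹' Vx) ∩ f ⁻¹' Vy = ∅ ∧ f ⁻¹' Vx ∩ closure (f ⁻¹' Vy) = ∅

/-- A class of topological spaces. -/
abbrev SpaceClass : Type (u + 1) := ∀ X : Type u, TopologicalSpace X → Prop

/-- The class of metrizable spaces. -/
def metrizableClass : SpaceClass.{u} := fun X t => @TopologicalSpace.MetrizableSpace X t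

/-- `E` is a `C(K)`-space: `E` is Hausdorff and every nearly continuous map with closed graph from
a Hausdorff space in the class `K` to `E` is continuous. -/
def IsCSpace (K : SpaceClass.{u}) (E : Type u) [TopologicalSpace E] : Prop :=
  T2Space E ∧ ∀ (F : Type u) [tF : TopologicalSpace F] [T2Space F], K F tF →
    ∀ f : F → E, NearlyContinuous f → HasClosedGraph f → Continuous f

/-- `E` is a `C_s(K)`-space: `E` is Hausdorff and every nearly continuous separating map from
a Hausdorff space in the class `K` to `E` is continuous. -/
def IsCsSpace (K : SpaceClass.{u}) (E : Type u) [TopologicalSpace E] : Prop :=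
  T2Space E ∧ ∀ (F : Type u) [tF : TopologicalSpace F] [T2Space F], K F tF →
    ∀ f : F → E, NearlyContinuous f → IsSeparatingMap f → Continuous f

/-- `E` is F-hereditary Baire: every closed subspace of `E` is a Baire space. -/
def IsFHereditaryBaire (E : Type*) [TopologicalSpace E] : Prop :=
  ∀ A : Set E, IsClosed A → BaireSpace A

/-! Suppose a closed subspace of `E` is not Baire. As in Hurewicz's theorem, it contains a closed
copy of a countable metrizable space without isolated points, here `EventuallyFalse`
(`exists_isClosedEmbedding_of_not_baireSpace`). This space carries a strictly coarser metrizable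
topology, induced by `xorHead`. The clopen halves `b 0 = false` and `b 0 = true` both become dense,
so the identity from the coarse to the fine topology is discontinuous; it is nearly continuous
because each half keeps its own topology. Composed with the closed embedding into `E`, it stays
separating, since the coarse topology is Hausdorff. This contradicts the `C_s` property, and the `C`
case follows because separating maps have closed graph. -/

/-- The sequences of booleans that are eventually `false`, as a subspace of the Cantor space. -/
abbrev EventuallyFalse : Type := {b : ℕ → Bool // ∃ N, ∀ n, N ≤ n → b n = false}

theorem eventually_forall_lt_eq (b : ℕ → Bool) (N : ℕ) : ∀ᶠ c in 𝓝 b, ∀ i < N, c i = b i := by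
  have h : ∀ᶠ c in 𝓝 b, ∀ i ∈ Set.Iio N, c i = b i := by
    rw [Filter.eventually_all_finite (Set.finite_Iio N)]
    intro i _
    exact (continuous_apply i).continuousAt.eventually (f := fun c : ℕ → Bool => c i)
      (p := fun t => t = b i) (by simp)
  exact h

theorem exists_forall_lt_eq_subset {b : ℕ → Bool} {s : Set (ℕ → Bool)} (hs : s ∈ 𝓝 b) :
    ∃ N, ∀ c : ℕ → Bool, (∀ i < N, c i = b i) → c ∈ s := by
  rw [nhds_pi, Filter.mem_pi] at hs
  obtain ⟨I, hI, t, ht, hts⟩ := hs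
  obtain ⟨N, hN⟩ := hI.bddAbove
  refine ⟨N + 1, fun c hc => hts fun i hi => ?_⟩
  rw [hc i (Nat.lt_succ_of_le (hN hi))]
  exact mem_of_mem_nhds (ht i)

/-! ### Closed copies of `EventuallyFalse` in spaces of the first category -/

/-- As the `O n` have empty intersection, `x` misses some `O k`; any point of the dense set `O (max
n k)` near `x` therefore differs from `x`. -/
theorem exists_disjoint_closedBalls {X : Type*} [MetricSpace X] {O : ℕ → Set X}
    (ho : ∀ n, IsOpen (O n)) (hd : ∀ n, Dense (O n)) (ha : Antitone O) (he : ⋂ n, O n = ∅)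
    (n : ℕ) (x : X) {r : ℝ} (hr : 0 < r) :
    ∃ (y : X) (ρ : ℝ), 0 < ρ ∧ ρ ≤ (1 / 2) ^ n ∧ ρ ≤ r ∧
      Metric.closedBall y ρ ⊆ Metric.closedBall x r ∧
      Disjoint (Metric.closedBall x ρ) (Metric.closedBall y ρ) ∧
      Metric.closedBall y ρ ⊆ O n := by
  obtain ⟨k, hk⟩ : ∃ k, x ∉ O k := by
    by_contra! h
    exact (he ▸ mem_iInter.2 h : x ∈ (∅ : Set X))
  obtain ⟨y, hy, hyO⟩ := (hd (max n k)).exists_mem_open Metric.isOpen_ball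
    ⟨x, Metric.mem_ball_self hr⟩ |>.imp fun _ h => And.symm h
  have hxy : 0 < dist x y := dist_pos.2 fun h => hk (ha (le_max_right n k) (h ▸ hyO))
  obtain ⟨ε, hε, hεO⟩ := Metric.nhds_basis_closedBall.mem_iff.1
    ((ho n).mem_nhds (ha (le_max_left n k) hyO))
  have hyr : 0 < r - dist y x := sub_pos.2 hy
  -- The bound `r - dist y x` keeps the new ball inside the old one, `ε` keeps it in `O n`, and a
  -- third of the distance makes the two balls disjoint.
  refine ⟨y, min (min ((1 / 2) ^ n) r) (min (min ε (r - dist y x)) (dist x y / 3)), by positivity,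
    by simp, by simp, ?_, ?_, ?_⟩
  · exact Metric.closedBall_subset_closedBall' (by
      linarith [min_le_right (min ((1 / 2 : ℝ) ^ n) r) (min (min ε (r - dist y x)) (dist x y / 3)),
        min_le_left (min ε (r - dist y x)) (dist x y / 3), min_le_right ε (r - dist y x)])
  · exact Metric.closedBall_disjoint_closedBall (by
      linarith [min_le_right (min ((1 / 2 : ℝ) ^ n) r) (min (min ε (r - dist y x)) (dist x y / 3)),
        min_le_right (min ε (r - dist y x)) (dist x y / 3)])
  · exact (Metric.closedBall_subset_closedBall ((min_le_right _ _).trans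
      ((min_le_left _ _).trans (min_le_left _ _)))).trans hεO

/-- The center and radius of the ball at level `n` along the branch `b` in the binary scheme in
which a ball passes to a ball with the same center on `false`, and to the ball centered at
`c n x r` on `true`. -/
def schemeBall {X : Type*} (c : ℕ → X → ℝ → X) (ρ : ℕ → X → ℝ → ℝ) (x₀ : X) :
    ℕ → (ℕ → Bool) → X × ℝ
  | 0, _ => (x₀, 1)
  | n + 1, b =>
    let p := schemeBall c ρ x₀ n b
    (if b n then c n p.1 p.2 else p.1, ρ n p.1 p.2)

theorem schemeBall_congr {X : Type*} (c : ℕ → X → ℝ → X) (ρ : ℕ → X → ℝ → ℝ) (x₀ : X) (n : ℕ)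
    {a b : ℕ → Bool} (h : ∀ i < n, a i = b i) : schemeBall c ρ x₀ n a = schemeBall c ρ x₀ n b := by
  induction n with
  | zero => rfl
  | succ n ih =>
    simp only [schemeBall, ih fun i hi => h i (hi.trans n.lt_succ_self), h n n.lt_succ_self]

/-- An eventually false branch has an eventually constant center, which lies in all its balls. A
branch with infinitely many `true` would put a common point in every `O n`, so it has none. The
pairs (branch, common point) form a closed set, and projecting along the compact Cantor space shows
that the embedding is closed. -/
theorem exists_isClosedEmbedding_eventuallyFalse {X : Type*} [MetricSpace X] [Nonempty X]
    {O : ℕ → Set X} (ho : ∀ n, IsOpen (O n)) (hd : ∀ n, Dense (O n)) (ha : Antitone O)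
    (he : ⋂ n, O n = ∅) : ∃ φ : EventuallyFalse → X, IsClosedEmbedding φ := by
  have step : ∀ (n : ℕ) (x : X) (r : ℝ), ∃ (y : X) (ρ : ℝ), 0 < r → 0 < ρ ∧ ρ ≤ (1 / 2) ^ n ∧
      ρ ≤ r ∧ Metric.closedBall y ρ ⊆ Metric.closedBall x r ∧
      Disjoint (Metric.closedBall x ρ) (Metric.closedBall y ρ) ∧
      Metric.closedBall y ρ ⊆ O n := by
    intro n x r
    by_cases hr : 0 < r
    · obtain ⟨y, ρ, h⟩ := exists_disjoint_closedBalls ho hd ha he n x hr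
      exact ⟨y, ρ, fun _ => h⟩
    -- Junk value: radii in the scheme are always positive.
    · exact ⟨x, 0, fun h => absurd h hr⟩
  choose c ρ hstep using step
  obtain ⟨x₀⟩ := ‹Nonempty X›
  set P := schemeBall c ρ x₀ with hP
  have hPs : ∀ n b, P (n + 1) b =
      (if b n then c n (P n b).1 (P n b).2 else (P n b).1, ρ n (P n b).1 (P n b).2) :=
    fun n b => rfl
  have hpos : ∀ n b, 0 < (P n b).2 := by
    intro n b
    induction n with
    | zero => exact one_pos
    | succ n ih => exact (hstep n _ _ ih).1
  let K : ℕ → (ℕ → Bool) → Set X := fun n b => Metric.closedBall (P n b).1 (P n b).2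
  have hKcongr : ∀ {n a b}, (∀ i < n, a i = b i) → K n a = K n b := by
    intro n a b h
    simp only [K, hP, schemeBall_congr c ρ x₀ n h]
  have hKanti : ∀ b, Antitone fun n => K n b := by
    intro b
    refine antitone_nat_of_succ_le fun n => ?_
    obtain ⟨-, -, h3, h4, -, -⟩ := hstep n (P n b).1 _ (hpos n b)
    simp only [K, hPs]
    split_ifs
    · exact h4
    · exact Metric.closedBall_subset_closedBall h3
  have hKdist : ∀ n b x y, x ∈ K (n + 1) b → y ∈ K (n + 1) b → dist x y ≤ 2 * (1 / 2) ^ n := by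
    intro n b x y hx hy
    have h2 : (P (n + 1) b).2 ≤ (1 / 2) ^ n := (hstep n (P n b).1 _ (hpos n b)).2.1
    have := dist_triangle_right x y (P (n + 1) b).1
    linarith [Metric.mem_closedBall.1 hx, Metric.mem_closedBall.1 hy]
  have hlim : Filter.Tendsto (fun n : ℕ => 2 * (1 / 2 : ℝ) ^ n) Filter.atTop (𝓝 0) := by
    simpa using (tendsto_pow_atTop_nhds_zero_of_lt_one (r := (1 / 2 : ℝ)) (by norm_num)
      (by norm_num)).const_mul 2
  have hKO : ∀ n b, b n = true → K (n + 1) b ⊆ O n := by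
    intro n b hb
    simpa [K, hPs, hb] using (hstep n (P n b).1 _ (hpos n b)).2.2.2.2.2
  have hKdisj : ∀ n a b, (∀ i < n, a i = b i) → a n ≠ b n →
      Disjoint (K (n + 1) a) (K (n + 1) b) := by
    intro n a b h hab
    have hPn : P n a = P n b := schemeBall_congr c ρ x₀ n h
    have h5 := (hstep n (P n b).1 _ (hpos n b)).2.2.2.2.1
    cases hb : b n <;> simp only [hb, ne_eq, Bool.not_eq_false, Bool.not_eq_true] at hab <;>
      simp only [K, hPs, hPn, hb, hab, if_true, Bool.false_eq_true, if_false]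
    · exact h5.symm
    · exact h5
  have hinj : ∀ a b y, (∀ n, y ∈ K n a) → (∀ n, y ∈ K n b) → a = b := by
    intro a b y hya hyb
    by_contra hab
    have hex : ∃ n, a n ≠ b n := Function.ne_iff.1 hab
    classical
    exact disjoint_left.1 (hKdisj (Nat.find hex) a b
      (fun i hi => not_not.1 (Nat.find_min hex hi)) (Nat.find_spec hex)) (hya _) (hyb _)
  have hexists : ∀ g : EventuallyFalse, ∃ y, ∀ n, y ∈ K n g := by
    rintro ⟨b, N, hN⟩
    have hconst : ∀ k, (P (N + k) b).1 = (P N b).1 := by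
      intro k
      induction k with
      | zero => rfl
      | succ k ih => rw [← ih, ← add_assoc, hPs, hN _ (Nat.le_add_right N k)]; rfl
    refine ⟨(P N b).1, fun n => hKanti b (Nat.le_add_left n N) ?_⟩
    rw [← hconst n]
    exact Metric.mem_closedBall_self (hpos _ _).le
  have hfinite : ∀ b y, (∀ n, y ∈ K n b) → ∃ N, ∀ n, N ≤ n → b n = false := by
    intro b y hy
    by_contra! h
    have hyO : y ∈ ⋂ n, O n := mem_iInter.2 fun n => by
      obtain ⟨m, hm, hbm⟩ := h n
      exact ha hm (hKO m b (by simpa using hbm) (hy _))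
    rw [he] at hyO
    exact hyO
  have hclosed : IsClosed {p : (ℕ → Bool) × X | ∀ n, p.2 ∈ K n p.1} := by
    rw [ofPred_forall]
    refine isClosed_iInter fun n => ?_
    have hcont : Continuous (P n) := by
      refine IsLocallyConstant.continuous ((IsLocallyConstant.iff_eventually_eq _).2 fun b => ?_)
      filter_upwards [eventually_forall_lt_eq b n] with a h
      exact schemeBall_congr c ρ x₀ n h
    exact isClosed_le (continuous_snd.dist (hcont.comp continuous_fst).fst)
      (hcont.comp continuous_fst).snd
  choose φ hφ using hexists
  have huniq : ∀ (g : EventuallyFalse) y, (∀ n, y ∈ K n g) → y = φ g := by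
    intro g y hy
    refine dist_le_zero.1 (ge_of_tendsto' hlim fun n => hKdist n g _ _ (hy _) (hφ g _))
  refine ⟨φ, IsClosedEmbedding.of_continuous_injective_isClosedMap ?_ ?_ ?_⟩
  · refine continuous_iff_continuousAt.2 fun g => Metric.tendsto_nhds.2 fun ε hε => ?_
    obtain ⟨n, hn⟩ := (hlim.eventually_lt_const hε).exists
    filter_upwards [continuous_subtype_val.continuousAt.eventually
      (eventually_forall_lt_eq g.1 (n + 1))] with h hh
    exact (hKdist n g _ _ (hKcongr hh ▸ hφ h (n + 1)) (hφ g _)).trans_lt hn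
  · intro g h hgh
    exact Subtype.ext (hinj _ _ (φ g) (hφ g) (hgh ▸ hφ h))
  · intro S hS
    obtain ⟨T, hT, rfl⟩ := isClosed_induced_iff.1 hS
    have himage : φ '' (Subtype.val ⁻¹' T) =
        Prod.snd '' ({p : (ℕ → Bool) × X | ∀ n, p.2 ∈ K n p.1} ∩ Prod.fst ⁻¹' T) := by
      ext y
      constructor
      · rintro ⟨g, hg, rfl⟩
        exact ⟨(g.1, φ g), ⟨hφ g, hg⟩, rfl⟩
      · rintro ⟨⟨b, z⟩, ⟨hz, hb⟩, rfl⟩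
        exact ⟨⟨b, hfinite b z hz⟩, hb, (huniq ⟨b, hfinite b z hz⟩ z hz).symm⟩
    rw [himage]
    exact isClosedMap_snd_of_compactSpace _ (hclosed.inter (hT.preimage continuous_fst))

/-- On the closure of the open set `U` missed by the intersection, the traces of `U ∩ D n` are
dense, open and decreasing with empty intersection. -/
theorem exists_isClosedEmbedding_of_not_baireSpace {X : Type*} [MetricSpace X]
    (h : ¬ BaireSpace X) : ∃ φ : EventuallyFalse → X, IsClosedEmbedding φ := by
  obtain ⟨f, hfo, hfd, hf⟩ : ∃ f : ℕ → Set X, (∀ n, IsOpen (f n)) ∧ (∀ n, Dense (f n)) ∧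
      ¬ Dense (⋂ n, f n) := by
    by_contra! hcon
    exact h ⟨hcon⟩
  set U : Set X := (closure (⋂ n, f n))ᶜ with hU
  have hUo : IsOpen U := isClosed_closure.isOpen_compl
  have hUne : U.Nonempty := by
    rw [hU, nonempty_compl]
    exact fun h' => hf (dense_iff_closure_eq.2 h')
  let D : ℕ → Set X := fun n => ⋂ i ∈ Set.Iic n, f i
  have hDo : ∀ n, IsOpen (D n) := fun n => (Set.finite_Iic n).isOpen_biInter fun i _ => hfo i
  have hDd : ∀ n, Dense (D n) := by
    intro n
    induction n with
    | zero => simpa [D] using hfd 0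
    | succ n ih =>
      have : D (n + 1) = D n ∩ f (n + 1) := by
        ext x
        simp only [D, mem_iInter, mem_Iic, mem_inter_iff]
        exact ⟨fun H => ⟨fun i hi => H i (by omega), H _ le_rfl⟩, fun H i hi =>
          (Nat.le_succ_iff.1 hi).elim (H.1 i) fun e => e ▸ H.2⟩
      rw [this]
      exact ih.inter_of_isOpen_left (hfd _) (hDo n)
  let O : ℕ → Set (closure U) := fun n => Subtype.val ⁻¹' (U ∩ D n)
  have : Nonempty (closure U) := hUne.closure.to_subtype
  obtain ⟨φ, hφ⟩ := exists_isClosedEmbedding_eventuallyFalse (O := O)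
    (fun n => (hUo.inter (hDo n)).preimage continuous_subtype_val)
    (fun n => by
      rw [Subtype.dense_iff, Subtype.image_preimage_coe,
        inter_eq_self_of_subset_right (inter_subset_left.trans subset_closure)]
      exact closure_minimal ((hDd n).open_subset_closure_inter hUo) isClosed_closure)
    (fun m n hmn x hx => ⟨hx.1, biInter_mono (Iic_subset_Iic.2 hmn) (fun _ _ => le_rfl) hx.2⟩)
    (by
      refine eq_empty_of_forall_notMem fun x hx => ?_
      rw [mem_iInter] at hx
      refine (hx 0).1 (subset_closure (mem_iInter.2 fun n => ?_))
      exact mem_iInter₂.1 (hx n).2 n (mem_Iic.2 le_rfl))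
  exact ⟨_, isClosed_closure.isClosedEmbedding_subtypeVal.comp hφ⟩

/-! ### A coarser topology on `EventuallyFalse` -/

/-- The coding `b ↦ (b 1 + b 0, b 2 + b 0, …)` (mod 2). It is injective and continuous on
`EventuallyFalse`, and maps each of the clopen sets `b 0 = false` and `b 0 = true` homeomorphically
onto a dense subspace of the Cantor space. -/
def xorHead (g : EventuallyFalse) : ℕ → Bool := fun n => xor (g.1 (n + 1)) (g.1 0)

theorem continuous_xorHead : Continuous xorHead := by
  refine continuous_pi fun n => ?_
  have hxor : Continuous fun p : Bool × Bool => xor p.1 p.2 := continuous_of_discreteTopology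
  have hcoord : ∀ k, Continuous fun g : EventuallyFalse => g.1 k :=
    fun k => (continuous_apply k).comp continuous_subtype_val
  exact hxor.comp ((hcoord (n + 1)).prodMk (hcoord 0))

theorem injective_xorHead : Function.Injective xorHead := by
  rintro ⟨a, N, hN⟩ ⟨b, M, hM⟩ h
  have hn : ∀ n, xor (a (n + 1)) (a 0) = xor (b (n + 1)) (b 0) := fun n => congrFun h n
  have h0 : a 0 = b 0 := by
    -- Past both tails the coding just repeats the head.
    simpa [hN (N + M + 1) (by omega), hM (N + M + 1) (by omega)] using hn (N + M)
  refine Subtype.ext (funext fun n => ?_)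
  cases n with
  | zero => exact h0
  | succ n => simpa [h0] using hn n

/-- The eventually false sequence with head `t` whose coding agrees with `z` below `M`. -/
def xorHeadApprox (t : Bool) (z : ℕ → Bool) (M : ℕ) : EventuallyFalse :=
  ⟨fun n => if n = 0 then t else if n ≤ M then xor (z (n - 1)) t else false,
    M + 1, fun n hn => by simp [show n ≠ 0 by omega, show ¬ n ≤ M by omega]⟩

theorem xorHeadApprox_zero (t : Bool) (z : ℕ → Bool) (M : ℕ) : (xorHeadApprox t z M).1 0 = t := rfl

theorem xorHeadApprox_succ (t : Bool) (z : ℕ → Bool) {M n : ℕ} (hn : n < M) :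
    (xorHeadApprox t z M).1 (n + 1) = xor (z n) t := by
  simp [xorHeadApprox, Nat.succ_le_of_lt hn]

theorem xorHead_xorHeadApprox (t : Bool) (z : ℕ → Bool) {M n : ℕ} (hn : n < M) :
    xorHead (xorHeadApprox t z M) n = z n := by
  simp [xorHead, xorHeadApprox_zero, xorHeadApprox_succ t z hn]

/-- `EventuallyFalse` with the topology induced by `xorHead`. -/
abbrev XorSpace : Type u := ULift.{u} (Set.range xorHead)

/-- The identity of `EventuallyFalse`, seen as a map from the coarser topology. -/
noncomputable def XorSpace.decode (x : XorSpace.{u}) : EventuallyFalse := x.down.2.choose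

theorem XorSpace.xorHead_decode (x : XorSpace.{u}) : xorHead x.decode = x.down.1 :=
  x.down.2.choose_spec

/-- The inverse of `XorSpace.decode`. -/
def XorSpace.encode (g : EventuallyFalse) : XorSpace.{u} := ⟨⟨xorHead g, mem_range_self g⟩⟩

theorem XorSpace.decode_encode (g : EventuallyFalse) :
    (XorSpace.encode.{u} g).decode = g :=
  injective_xorHead (XorSpace.xorHead_decode _)

theorem XorSpace.isEmbedding_down : IsEmbedding fun x : XorSpace.{u} => x.down.1 :=
  IsEmbedding.subtypeVal.comp Homeomorph.ulift.isEmbedding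

theorem XorSpace.nearlyContinuous_decode : NearlyContinuous XorSpace.decode.{u} := by
  intro V hV x hx
  set g := x.decode with hg
  obtain ⟨T, hT, rfl⟩ := isOpen_induced_iff.1 hV
  obtain ⟨N, hN⟩ := exists_forall_lt_eq_subset (hT.mem_nhds hx)
  rw [mem_interior_iff_mem_nhds]
  filter_upwards [XorSpace.isEmbedding_down.continuous.continuousAt.eventually
    (eventually_forall_lt_eq x.down.1 N)] with y hy
  rw [mem_closure_iff_nhds]
  intro S hS
  rw [XorSpace.isEmbedding_down.nhds_eq_comap] at hS
  obtain ⟨S', hS', hSS⟩ := hS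
  obtain ⟨M, hM⟩ := exists_forall_lt_eq_subset hS'
  -- Agreement below `M` puts the point in the coarse neighborhood of `y`; agreement below `N`, with
  -- the head of `g`, puts it in the fine neighborhood of `g`.
  set h := xorHeadApprox (g.1 0) y.down.1 (max M N)
  refine ⟨XorSpace.encode h, hSS (hM _ fun i hi => ?_), ?_⟩
  · exact xorHead_xorHeadApprox _ _ (hi.trans_le (le_max_left _ _))
  · rw [mem_preimage, XorSpace.decode_encode]
    refine hN _ fun i hi => ?_
    cases i with
    | zero => rfl
    | succ i =>
      have hi' : i < N := i.lt_succ_self.trans hi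
      rw [xorHeadApprox_succ _ _ (hi'.trans_le (le_max_right _ _)), hy i hi',
        ← XorSpace.xorHead_decode x]
      simp [xorHead, hg]

/-- The half with head `true` accumulates, in the coarse topology, at the zero sequence, whose head
is `false`. -/
theorem XorSpace.not_continuous_decode : ¬ Continuous XorSpace.decode.{u} := by
  intro hc
  let z : EventuallyFalse := ⟨fun _ => false, 0, fun _ _ => rfl⟩
  have hev : ∀ᶠ x in 𝓝 (XorSpace.encode.{u} z), x.decode.1 0 = false := by
    have := (continuous_subtype_val.comp hc).continuousAt.eventually
      (eventually_forall_lt_eq (XorSpace.encode.{u} z).decode.1 1)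
    filter_upwards [this] with x hx
    simpa [XorSpace.decode_encode, z] using hx 0 one_pos
  rw [Filter.Eventually, XorSpace.isEmbedding_down.nhds_eq_comap] at hev
  obtain ⟨S, hS, hSS⟩ := hev
  obtain ⟨M, hM⟩ := exists_forall_lt_eq_subset hS
  have hmem : XorSpace.encode.{u} (xorHeadApprox true (xorHead z) M) ∈
      {x : XorSpace.{u} | x.decode.1 0 = false} :=
    hSS (hM _ fun i hi => xorHead_xorHeadApprox true (xorHead z) hi)
  rw [mem_ofPred_eq, XorSpace.decode_encode, xorHeadApprox_zero] at hmem
  exact Bool.noConfusion hmem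

/-- Coarsely open sets are finely open, hence preimages of open sets of `E`; disjoint ones separate
points of the range. A point off the closed range has a neighborhood with empty preimage. -/
theorem XorSpace.isSeparatingMap_comp_decode {E : Type*} [TopologicalSpace E]
    {φ : EventuallyFalse → E} (hφ : IsClosedEmbedding φ) :
    IsSeparatingMap (φ ∘ XorSpace.decode.{u}) := by
  have hempty : (φ ∘ XorSpace.decode.{u}) ⁻¹' (range φ)ᶜ = ∅ :=
    eq_empty_of_forall_notMem fun x hx => hx (mem_range_self _)
  intro y z hyz
  by_cases hy : y ∈ range φ
  swap
  · exact ⟨_, hφ.isClosed_range.isOpen_compl.mem_nhds hy, univ, Filter.univ_mem, by simp [hempty]⟩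
  by_cases hz : z ∈ range φ
  swap
  · exact ⟨univ, Filter.univ_mem, _, hφ.isClosed_range.isOpen_compl.mem_nhds hz, by simp [hempty]⟩
  obtain ⟨g, rfl⟩ := hy
  obtain ⟨h, rfl⟩ := hz
  have hgh : xorHead g ≠ xorHead h := fun e => hyz (congrArg φ (injective_xorHead e))
  obtain ⟨A, B, hA, hB, hgA, hhB, hAB⟩ := t2_separation hgh
  have key : ∀ {A : Set (ℕ → Bool)} {g : EventuallyFalse}, IsOpen A → xorHead g ∈ A →
      ∃ V ∈ 𝓝 (φ g), (φ ∘ XorSpace.decode.{u}) ⁻¹' V = (fun x => x.down.1) ⁻¹' A := by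
    intro A g hA hg
    obtain ⟨V, hV, hVA⟩ := hφ.isInducing.isOpen_iff.1 (hA.preimage continuous_xorHead)
    refine ⟨V, hV.mem_nhds (show g ∈ φ ⁻¹' V from hVA ▸ hg), ?_⟩
    rw [preimage_comp, hVA]
    ext x
    simp only [mem_preimage, XorSpace.xorHead_decode]
  obtain ⟨V, hV, hVA⟩ := key hA hgA
  obtain ⟨W, hW, hWB⟩ := key hB hhB
  have hcont := XorSpace.isEmbedding_down.{u}.continuous
  have hdisj := hAB.preimage fun x : XorSpace.{u} => x.down.1
  refine ⟨V, hV, W, hW, ?_, ?_⟩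
  · rw [hVA, hWB]
    exact (hdisj.closure_left (hB.preimage hcont)).inter_eq
  · rw [hVA, hWB]
    exact (hdisj.closure_right (hA.preimage hcont)).inter_eq

/-! ### Closed graph spaces -/

theorem IsSeparatingMap.hasClosedGraph {F E : Type*} [TopologicalSpace F] [TopologicalSpace E]
    {f : F → E} (hf : IsSeparatingMap f) : HasClosedGraph f := by
  refine isOpen_compl_iff.1 (isOpen_iff_mem_nhds.2 ?_)
  rintro ⟨x, y⟩ hxy
  obtain ⟨V, hV, W, hW, -, hVW⟩ := hf (f x) y hxy
  have hx : x ∉ closure (f ⁻¹' W) :=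
    disjoint_left.1 (disjoint_iff_inter_eq_empty.2 hVW) (mem_of_mem_nhds hV : f x ∈ V)
  filter_upwards [prod_mem_nhds (isClosed_closure.isOpen_compl.mem_nhds hx) hW]
  rintro ⟨a, b⟩ ⟨ha, hb⟩ hab
  have hab' : f a = b := hab
  exact ha (subset_closure (show f a ∈ W from hab' ▸ hb))

theorem IsCSpace.isCsSpace {K : SpaceClass.{u}} {E : Type u} [TopologicalSpace E]
    (h : IsCSpace K E) : IsCsSpace K E :=
  ⟨h.1, fun F _ _ hF f hf hs => h.2 F hF f hf hs.hasClosedGraph⟩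

theorem IsCsSpace.isFHereditaryBaire {E : Type u} [TopologicalSpace E]
    [TopologicalSpace.MetrizableSpace E] (h : IsCsSpace metrizableClass.{u} E) :
    IsFHereditaryBaire E := by
  intro A hA
  by_contra hB
  let _ := TopologicalSpace.metrizableSpaceMetric E
  obtain ⟨ψ, hψ⟩ := exists_isClosedEmbedding_of_not_baireSpace hB
  have hφ := hA.isClosedEmbedding_subtypeVal.comp hψ
  have hmet : metrizableClass.{u} XorSpace.{u} inferInstance :=
    XorSpace.isEmbedding_down.metrizableSpace
  have : T2Space XorSpace.{u} := XorSpace.isEmbedding_down.t2Space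
  have hcont := h.2 XorSpace.{u} hmet _
    (fun V hV => XorSpace.nearlyContinuous_decode _ (hV.preimage hφ.continuous))
    (XorSpace.isSeparatingMap_comp_decode hφ)
  exact XorSpace.not_continuous_decode (hφ.isInducing.continuous_iff.2 hcont)

theorem mainTheorem12 (E : Type u) [TopologicalSpace E] [TopologicalSpace.MetrizableSpace E] :
    (IsCsSpace metrizableClass.{u} E → IsFHereditaryBaire E) ∧
      (IsCSpace metrizableClass.{u} E → IsFHereditaryBaire E) :=
  ⟨fun h => h.isFHereditaryBaire, fun h => h.isCsSpace.isFHereditaryBaire⟩
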